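/- Let $M\ge 1$ and $g_i=\rho\,\bar\gamma\,\|\mathbf h_{ps}\|^2|h_i|^2$ for $0\le i\le M$, where $\rho>0$ (energy harvesting factor), $\bar\gamma>0$ (transmit SNR), $\mathbf h_{ps}\in\mathbb C^N\setminus\{0\}$, and $h_0,\dots,h_M\in\mathbb C\setminus\{0\}$ are channels with $|h_0|^2\le\dots\le|h_M|^2$. Let $\bar R_0,\dots,\bar R_M\ge 0$ be target rates. For $\alpha\in\mathbb R^{M+1}$ put $I_i(\alpha)=\sum_{j=i+1}^{M}\alpha_j g_i+1$ and $\mathrm{SINR}_i(\alpha)=\alpha_i g_i/I_i(\alpha)$. Consider the constraints on $\alpha$ $$\text{(A)}\quad \alpha_i g_i\ge(2^{\bar R_i}-1)\,I_i(\alpha)\ (0\le i\le M),\qquad \alpha_0\ge\alpha_1\ge\dots\ge\alpha_M,\qquad \sum_{i=0}^M\alpha_i\le 1 ,$$ and the following problems, in all of which the objective $\prod_{i=0}^M t_i$ is maximised over its domain $t\in[0,\infty)^{M+1}$. * Problem (P), in $(\alpha,t)$: (A) and $\mathrm{SINR}_i(\alpha)\ge t_i-1$ for $0\le i\le M$. *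 Problem (Q), in $(\alpha,t,z)$ with $z=(z_0,\dots,z_{M-1})$: (A), $\alpha_Mg_M\ge t_M-1$, and, for $0\le i\le M-1$, $I_i(\alpha)\le z_i$ and $\alpha_i g_i\ge z_it_i-z_i$. * Convex program $(C_{\hat t,\hat z})$, in $(\alpha,t,z)$: the same as (Q), but with $\alpha_ig_i\ge z_it_i-z_i$ replaced, for $0\le i\le M-1$, by $$\alpha_i g_i\ \ge\ \tfrac14(z_i+t_i)^2-z_i-\tfrac14\Big[(\hat z_i-\hat t_i)^2+2(\hat z_i-\hat t_i)(z_i-\hat z_i-t_i+\hat t_i)\Big].$$ Algorithm: start from a feasible point $(\alpha^{(0)},t^{(0)},z^{(0)})$ of (Q); given $(t^{(\tau)},z^{(\tau)})$, let $(\alpha^{(\tau+1)},t^{(\tau+1)},z^{(\tau+1)})$ be any optimal solution of $(C_{t^{(\tau)},z^{(\tau)}})$. Then: 1. From every feasible point of (Q) the algorithm can be run, i.e. the convex programs that arise have optimal solutions. Moreover, for every run of the algorithm: 2. Every iterate is feasible for (Q) and for the convex program $(C_{t^{(\tau)},z^{(\tau)}})$ at itself, and $(\alpha^{(\tau)},t^{(\tau)})$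 is feasible for (P). 3. The sequence $F_\tau=\prod_{i=0}^M t_i^{(\tau)}$ is monotonically increasing, with $F_\tau<F_{\tau+1}$ whenever $t^{(\tau+1)}\ne t^{(\tau)}$. It converges to a finite limit $L$, and for every tolerance $\epsilon>0$ there is a finite $T$ such that $|F_{\tau+1}-F_\tau|<\epsilon$ and $|F_\tau-L|<\epsilon$ for all $\tau\ge T$. 4. For every $\tau\ge0$, the point $(\alpha^{(\tau+1)},t^{(\tau+1)},z^{(\tau+1)})$ has $t^{(\tau+1)}_i>0$ for all $i$ and satisfies the Karush-Kuhn-Tucker (KKT) conditions of the convex program $(C_{t^{(\tau)},z^{(\tau)}})$. 5. The sequence $(\alpha^{(\tau)},t^{(\tau)},z^{(\tau)})$ is bounded (so it has limit points). Every limit point $(\alpha^*,t^*,z^*)$ has $t^*_i>0$ for all $i$ and satisfies the KKT conditions of (Q). If all $\bar R_i>0$, then $(\alpha^*,t^*)$ also satisfies the KKT conditions of (P). Here the KKT conditions refer to the listed inequality constraints. They consist of primal feasibility and the existence of nonnegative multipliers with complementary slackness and stationarity of the Lagrangian. -/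

import Mathlib

open Filter Topology

noncomputable section

namespace NomaSumRate

/-- The data of the sum rate problem: a primary transmitter with `N` antennas, the selected
secondary transmitter (ST), and the receivers `0, …, M`, where `0` is the primary receiver and
`1, …, M` are the secondary receivers. -/
structure Network (N M : ℕ) where
  /-- The energy harvesting factor: the ST transmits with power `ρ P ‖hps‖ ^ 2`, where `P` is the
  power of the primary transmitter. -/
  rho : ℝ
  /-- The transmit signal-to-noise ratio. -/
  snr : ℝ
  /-- The channel from the primary transmitter to the ST. -/
  hps : EuclideanSpace ℂ (Fin N)
  /-- The channels from the ST to the receivers `0, …, M`. -/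
  h : Fin (M + 1) → ℂ
  /-- The target rates. -/
  Rbar : Fin (M + 1) → ℝ
  rho_pos : 0 < rho
  snr_pos : 0 < snr
  hps_ne : hps ≠ 0
  h_ne : ∀ i, h i ≠ 0
  h_mono : Monotone fun i => ‖h i‖ ^ 2
  Rbar_nonneg : ∀ i, 0 ≤ Rbar i

/-- The variables `(α, t, z)`: power allocation `α_0, …, α_M`, and the slack variables
`t_0, …, t_M` and `z_0, …, z_{M-1}`. -/
abbrev Var (M : ℕ) : Type := (Fin (M + 1) → ℝ) × (Fin (M + 1) → ℝ) × (Fin M → ℝ)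

/-- The power allocation `α` of a point `(α, t, z)`. -/
abbrev Var.al {M : ℕ} (x : Var M) : Fin (M + 1) → ℝ := x.1

/-- The slack vector `t` of a point `(α, t, z)`. -/
abbrev Var.t {M : ℕ} (x : Var M) : Fin (M + 1) → ℝ := x.2.1

/-- The slack vector `z` of a point `(α, t, z)`. -/
abbrev Var.z {M : ℕ} (x : Var M) : Fin M → ℝ := x.2.2

namespace Network

variable {N M : ℕ} (net : Network N M)

/-- The effective gain `ρ γ ‖hps‖² |h_i|²` of receiver `i`. -/
def gain (i : Fin (M + 1)) : ℝ := net.rho * net.snr * ‖net.hps‖ ^ 2 * ‖net.h i‖ ^ 2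

/-- Interference plus (normalised) noise when receiver `i` decodes its own signal after
successive interference cancellation: `∑_{j > i} α_j g_i + 1`. -/
def interf (al : Fin (M + 1) → ℝ) (i : Fin (M + 1)) : ℝ :=
  (∑ j ∈ Finset.Ioi i, al j * net.gain i) + 1

/-- The signal-to-interference-plus-noise ratio of receiver `i` for its own signal. -/
def sinr (al : Fin (M + 1) → ℝ) (i : Fin (M + 1)) : ℝ := al i * net.gain i / net.interf al i

end Network

/-- Indices of the constraints that involve `α` only: the rate (quality of service) constraints,
the ordering constraints and the total power constraint. -/
inductive AllocIdx (M : ℕ) : Type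
  | qos (i : Fin (M + 1))
  | order (i : Fin M)
  | power
  deriving Fintype

/-- Indices of the constraints of the problem in `(α, t)`. -/
inductive SlackIdx (M : ℕ) : Type
  | rate (i : Fin (M + 1))
  | alloc (k : AllocIdx M)
  deriving Fintype

/-- Indices of the constraints of the problems in `(α, t, z)`. -/
inductive SplitIdx (M : ℕ) : Type
  | interf (i : Fin M)
  | product (i : Fin M)
  | last
  | alloc (k : AllocIdx M)
  deriving Fintype

namespace Network

variable {N M : ℕ} (net : Network N M)

/-- The constraints on `α`, each in the form `0 ≤ allocCon k α`. -/
def allocCon : AllocIdx M → (Fin (M + 1) → ℝ) → ℝ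
  | .qos i, al => al i * net.gain i - ((2 : ℝ) ^ net.Rbar i - 1) * net.interf al i
  | .order i, al => al i.castSucc - al i.succ
  | .power, al => 1 - ∑ i, al i

/-- The constraints of the problem "maximise `∏ t_i` over `(α, t)`", each in the form
`0 ≤ slackCon k (α, t)`; in particular `SINR_i ≥ t_i - 1`. -/
def slackCon : SlackIdx M → (Fin (M + 1) → ℝ) × (Fin (M + 1) → ℝ) → ℝ
  | .rate i, y => net.sinr y.1 i - (y.2 i - 1)
  | .alloc k, y => net.allocCon k y.1

/-- The constraints of the problem in `(α, t, z)`, in which `SINR_i ≥ t_i - 1` for `i < M` is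
split into `∑_{j > i} α_j g_i + 1 ≤ z_i` and `α_i g_i ≥ z_i t_i - z_i`. -/
def splitCon : SplitIdx M → Var M → ℝ
  | .interf i, x => x.z i - net.interf x.al i.castSucc
  | .product i, x =>
      x.al i.castSucc * net.gain i.castSucc - (x.z i * x.t i.castSucc - x.z i)
  | .last, x => x.al (Fin.last M) * net.gain (Fin.last M) - (x.t (Fin.last M) - 1)
  | .alloc k, x => net.allocCon k x.al

/-- The constraints of the convex program at the reference point `r` (only the components `t` and
`z` of `r` matter): in `z_i t_i = ((z_i + t_i)² - (z_i - t_i)²) / 4` the square `(z_i - t_i)²` is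
replaced by its first-order Taylor expansion at the reference point. -/
def convexCon (r : Var M) : SplitIdx M → Var M → ℝ
  | .interf i, x => x.z i - net.interf x.al i.castSucc
  | .product i, x =>
      x.al i.castSucc * net.gain i.castSucc -
        (1 / 4 * (x.z i + x.t i.castSucc) ^ 2 - x.z i -
          1 / 4 * ((r.z i - r.t i.castSucc) ^ 2 +
            2 * (r.z i - r.t i.castSucc) *
              (x.z i - r.z i - x.t i.castSucc + r.t i.castSucc)))
  | .last, x => x.al (Fin.last M) * net.gain (Fin.last M) - (x.t (Fin.last M) - 1)
  | .alloc k, x => net.allocCon k x.al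

/-- Feasible points of the problem in `(α, t)`. -/
def slackFeasible : Set ((Fin (M + 1) → ℝ) × (Fin (M + 1) → ℝ)) :=
  {y | (∀ i, 0 ≤ y.2 i) ∧ ∀ k, 0 ≤ net.slackCon k y}

/-- Feasible points of the problem in `(α, t, z)`. The objective `∏ t_i` is considered on its
usual domain (that of the geometric mean), the orthant `t ≥ 0`. -/
def splitFeasible : Set (Var M) := {x | (∀ i, 0 ≤ x.t i) ∧ ∀ k, 0 ≤ net.splitCon k x}

/-- Feasible points of the convex program at the reference point `r`. -/
def convexFeasible (r : Var M) : Set (Var M) :=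
  {x | (∀ i, 0 ≤ x.t i) ∧ ∀ k, 0 ≤ net.convexCon r k x}

end Network

/-- The objective `∏ t_i` as a function of `(α, t, z)`. -/
def objective {M : ℕ} (x : Var M) : ℝ := ∏ i, x.t i

/-- The objective `∏ t_i` as a function of `(α, t)`. -/
def slackObjective {M : ℕ} (y : (Fin (M + 1) → ℝ) × (Fin (M + 1) → ℝ)) : ℝ := ∏ i, y.2 i

/-- The sequence `x` is a run of the iterative algorithm (without stopping rule): it starts at a
feasible point, and `x (τ + 1)` is an optimal solution of the convex program at `x τ`. -/
def Network.IsRun {N M : ℕ} (net : Network N M) (x : ℕ → Var M) : Prop :=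
  x 0 ∈ net.splitFeasible ∧
    ∀ τ, x (τ + 1) ∈ net.convexFeasible (x τ) ∧
      IsMaxOn objective (net.convexFeasible (x τ)) (x (τ + 1))

/-- The Karush-Kuhn-Tucker conditions at `x` for maximising `f` subject to `0 ≤ g k` for all `k`:
primal feasibility, and multipliers with dual feasibility, complementary slackness and
stationarity of the Lagrangian. -/
def IsKKT {E ι : Type*} [NormedAddCommGroup E] [NormedSpace ℝ E] [Fintype ι]
    (f : E → ℝ) (g : ι → E → ℝ) (x : E) : Prop :=
  DifferentiableAt ℝ f x ∧ (∀ k, DifferentiableAt ℝ (g k) x) ∧ (∀ k, 0 ≤ g k x) ∧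
    ∃ lam : ι → ℝ, (∀ k, 0 ≤ lam k) ∧ (∀ k, lam k * g k x = 0) ∧
      fderiv ℝ f x + ∑ k, lam k • fderiv ℝ (g k) x = 0

end NomaSumRate

end

noncomputable section

namespace NomaSumRate

/-! The algorithm is an inner approximation scheme. Since `z t = ((z + t)² - (z - t)²) / 4`,
replacing the convex square `(z - t)²` by its tangent at the reference point strengthens the product
constraint by exactly a quarter of the squared change of `z - t`. So every convex program lies
inside (Q), and at its own reference point it agrees with (Q) in value and derivative
(`convexCon_eq_splitCon_sub`, `fderiv_splitCon`). Each iterate is therefore feasible for the program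
it generates, which makes the objective monotone; it is bounded by `∏ (g_i + 1)`. Strict increase
comes from the strict log-concavity of `∏ t_i` on positive `t`.

KKT conditions come from Farkas' lemma under a Slater-type qualification (`isKKT_of_eventually_le`).
Only the product constraints are not affine, and moving `t` slightly towards `1/2` makes all of them
strict (`exists_strictly_feasible`).

Compactness of a single program bounds `z` only in terms of its reference point. The uniform bound
uses stationarity: either `z_i` equals the interference, or it obeys a recursion in `τ` that cannot
drift upwards (`z_eq_of_isKKT`, `IsRun.z_le`).

A limit point maximises the convex program at itself (`IsRun.isMaxOn_of_mapClusterPt`), so it is a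
KKT point of that program, and by tangency of (Q). Positive target rates force `z_i` to equal the
interference, so that `z` can be eliminated, which gives KKT for (P) (`isKKT_slackCon`). -/

/-! ### Farkas' lemma and first-order optimality conditions -/

/-- **Farkas' lemma** for finitely many continuous linear functionals. -/
theorem farkas {E ι : Type*} [NormedAddCommGroup E] [NormedSpace ℝ E] (s : Finset ι) :
    ∀ (φ : ι → E →L[ℝ] ℝ) (ψ : E →L[ℝ] ℝ), (∀ d, (∀ k ∈ s, 0 ≤ φ k d) → 0 ≤ ψ d) →
      ∃ lam : ι → ℝ, (∀ k, 0 ≤ lam k) ∧ ψ = ∑ k ∈ s, lam k • φ k := by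
  classical
  induction s using Finset.induction_on with
  | empty =>
    intro φ ψ h
    refine ⟨0, fun _ => le_rfl, ?_⟩
    ext d
    have h1 := h d (by simp)
    have h2 := h (-d) (by simp)
    rw [map_neg] at h2
    simpa using le_antisymm (by linarith) h1
  | insert a s ha ih =>
    intro φ ψ h
    by_cases hs : ∀ d, (∀ k ∈ s, 0 ≤ φ k d) → 0 ≤ ψ d
    · obtain ⟨lam, hlam, rfl⟩ := ih φ ψ hs
      refine ⟨Function.update lam a 0, fun k => ?_, ?_⟩
      · by_cases hk : k = a
        · simp [hk]
        · simpa [hk] using hlam k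
      · rw [Finset.sum_insert ha, Function.update_self, zero_smul, zero_add]
        refine Finset.sum_congr rfl fun k hk => ?_
        rw [Function.update_of_ne (ne_of_mem_of_not_mem hk ha)]
    · push Not at hs
      obtain ⟨u, hu, hψu⟩ := hs
      have hau : φ a u < 0 := by
        by_contra! hcon
        refine absurd (h u fun k hk => ?_) (not_le.mpr hψu)
        rcases Finset.mem_insert.mp hk with rfl | hk
        exacts [hcon, hu k hk]
      set c := (-(φ a u))⁻¹ with hc
      have hc0 : 0 < c := inv_pos.mpr (by linarith)
      have hcu : c * φ a u = -1 := by
        rw [hc, inv_neg, neg_mul, inv_mul_cancel₀ hau.ne]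
      -- Compose all functionals with `d ↦ d + c φ_a(d) u`, the projection onto `ker φ_a` along `u`.
      -- On its image the constraint `a` holds trivially, so `s` alone suffices; undoing the
      -- projection yields the coefficient of `φ a`, nonnegative because `ψ u < 0 ≤ φ k u`.
      obtain ⟨lam, hlam, hψ⟩ := ih (fun k => φ k + (c * φ k u) • φ a) (ψ + (c * ψ u) • φ a)
        (fun d hd => by
          have key := h (d + (c * φ a d) • u) (fun k hk => by
            rcases Finset.mem_insert.mp hk with rfl | hk
            · have : φ k (d + (c * φ k d) • u) = φ k d * (1 + c * φ k u) := by
                simp; ring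
              rw [this, hcu]; simp
            · have := hd k hk
              simp at this ⊢
              linarith)
          simp at key ⊢
          linarith)
      refine ⟨Function.update lam a (∑ k ∈ s, lam k * (c * φ k u) - c * ψ u), fun k => ?_, ?_⟩
      · by_cases hk : k = a
        · subst hk
          have h1 : 0 ≤ ∑ j ∈ s, lam j * (c * φ j u) :=
            Finset.sum_nonneg fun j hj => mul_nonneg (hlam j) (mul_nonneg hc0.le (hu j hj))
          have h2 : c * ψ u < 0 := mul_neg_of_pos_of_neg hc0 hψu
          simp only [Function.update_self]
          linarith
        · simpa [hk] using hlam k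
      · rw [Finset.sum_insert ha, Function.update_self]
        have hsum : ∑ k ∈ s, Function.update lam a
            (∑ k ∈ s, lam k * (c * φ k u) - c * ψ u) k • φ k = ∑ k ∈ s, lam k • φ k :=
          Finset.sum_congr rfl fun k hk => by
            rw [Function.update_of_ne (ne_of_mem_of_not_mem hk ha)]
        rw [hsum]
        ext d
        have hd := DFunLike.congr_fun hψ d
        simp only [add_apply, FunLike.coe_smul, Pi.smul_apply, smul_eq_mul,
          sum_apply, mul_add, Finset.sum_add_distrib, ← mul_assoc,
          ← Finset.sum_mul] at hd ⊢
        linarith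

/-- If a differentiable function is nonpositive along a segment starting at one of its zeros,
its derivative in that direction is nonpositive. -/
theorem fderiv_apply_nonpos {E : Type*} [NormedAddCommGroup E] [NormedSpace ℝ E]
    {f : E → ℝ} {x d : E} (hf : DifferentiableAt ℝ f x)
    (h : ∀ᶠ s in 𝓝[>] (0 : ℝ), f (x + s • d) ≤ f x) : fderiv ℝ f x d ≤ 0 := by
  have hd : HasDerivAt (fun s : ℝ => f (x + s • d)) (fderiv ℝ f x d) 0 :=
    hf.hasFDerivAt.hasLineDerivAt d
  have hs := (hasDerivAt_iff_tendsto_slope_zero.mp hd).mono_left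
    (nhdsWithin_mono 0 (fun s (hs : (0 : ℝ) < s) => ne_of_gt hs) : 𝓝[>] (0 : ℝ) ≤ 𝓝[≠] 0)
  refine le_of_tendsto hs ?_
  filter_upwards [h, self_mem_nhdsWithin] with s hs (hs0 : 0 < s)
  simp only [zero_add, zero_smul, add_zero, smul_eq_mul]
  exact mul_nonpos_of_nonneg_of_nonpos (inv_nonneg.mpr hs0.le) (by linarith)

/-- A differentiable function with positive derivative in a direction at a zero is positive
shortly after it in that direction. -/
theorem eventually_pos_of_fderiv_pos {E : Type*} [NormedAddCommGroup E] [NormedSpace ℝ E]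
    {f : E → ℝ} {x d : E} (hf : DifferentiableAt ℝ f x) (hx : f x = 0)
    (h : 0 < fderiv ℝ f x d) : ∀ᶠ s in 𝓝[>] (0 : ℝ), 0 < f (x + s • d) := by
  have hd : HasDerivAt (fun s : ℝ => f (x + s • d)) (fderiv ℝ f x d) 0 :=
    hf.hasFDerivAt.hasLineDerivAt d
  have hs := (hasDerivAt_iff_tendsto_slope_zero.mp hd).mono_left
    (nhdsWithin_mono 0 (fun s (hs : (0 : ℝ) < s) => ne_of_gt hs) : 𝓝[>] (0 : ℝ) ≤ 𝓝[≠] 0)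
  filter_upwards [hs.eventually_const_lt h, self_mem_nhdsWithin] with s hs (hs0 : 0 < s)
  simp only [zero_add, zero_smul, add_zero, smul_eq_mul, hx, sub_zero] at hs
  exact pos_of_mul_pos_right hs (inv_nonneg.mpr hs0.le)

/-- Local maximisers satisfy the KKT conditions if some direction `d₀` is feasible to first order
for all active constraints, and strictly so for those active constraints that are not affine. -/
theorem isKKT_of_eventually_le {E ι : Type*} [NormedAddCommGroup E] [NormedSpace ℝ E] [Fintype ι]
    {f : E → ℝ} {g : ι → E → ℝ} {x d₀ : E}
    (hf : DifferentiableAt ℝ f x) (hg : ∀ k, DifferentiableAt ℝ (g k) x) (hx : ∀ k, 0 ≤ g k x)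
    (hmax : ∀ᶠ y in 𝓝 x, (∀ k, 0 ≤ g k y) → f y ≤ f x)
    (hd₀ : ∀ k, g k x = 0 → 0 ≤ fderiv ℝ (g k) x d₀ ∧
      (0 < fderiv ℝ (g k) x d₀ ∨
        ∀ (s : ℝ) (d : E), g k (x + s • d) = g k x + s * fderiv ℝ (g k) x d)) :
    IsKKT f g x := by
  classical
  refine ⟨hf, hg, hx, ?_⟩
  have hline : ∀ d : E, Tendsto (fun s : ℝ => x + s • d) (𝓝[>] 0) (𝓝 x) := fun d => by
    have : Tendsto (fun s : ℝ => x + s • d) (𝓝 0) (𝓝 (x + (0 : ℝ) • d)) :=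
      (by fun_prop : Continuous fun s : ℝ => x + s • d).tendsto 0
    rw [zero_smul, add_zero] at this
    exact this.mono_left nhdsWithin_le_nhds
  have hstrict : ∀ d : E, (∀ k, g k x = 0 → 0 ≤ fderiv ℝ (g k) x d ∧
      (0 < fderiv ℝ (g k) x d ∨
        ∀ (s : ℝ) (d : E), g k (x + s • d) = g k x + s * fderiv ℝ (g k) x d)) →
      fderiv ℝ f x d ≤ 0 := by
    intro d hd
    refine fderiv_apply_nonpos hf ?_
    have hfeas : ∀ᶠ s in 𝓝[>] (0 : ℝ), ∀ k, 0 ≤ g k (x + s • d) := by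
      refine eventually_all.mpr fun k => ?_
      rcases (hx k).eq_or_lt with h0 | h0
      · obtain ⟨h1, h2 | h2⟩ := hd k h0.symm
        · exact (eventually_pos_of_fderiv_pos (hg k) h0.symm h2).mono fun s hs => hs.le
        · filter_upwards [self_mem_nhdsWithin] with s (hs : 0 < s)
          rw [h2, ← h0, zero_add]
          exact mul_nonneg hs.le h1
      · exact (((hg k).continuousAt.tendsto.comp (hline d)).eventually_const_lt h0).mono
          fun s hs => le_of_lt hs
    filter_upwards [hfeas, (hline d).eventually hmax] with s h1 h2 using h2 h1
  -- Adding a small multiple of `d₀` makes any direction of the linearised cone admissible for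
  -- `hstrict`; then the multiple tends to zero.
  have hcone : ∀ d : E, (∀ k, g k x = 0 → 0 ≤ fderiv ℝ (g k) x d) → fderiv ℝ f x d ≤ 0 := by
    intro d hd
    have hlim : Tendsto (fun s : ℝ => fderiv ℝ f x (d + s • d₀)) (𝓝[>] 0) (𝓝 (fderiv ℝ f x d)) := by
      have : Tendsto (fun s : ℝ => fderiv ℝ f x (d + s • d₀)) (𝓝 0)
          (𝓝 (fderiv ℝ f x (d + (0 : ℝ) • d₀))) :=
        (by fun_prop : Continuous fun s : ℝ => fderiv ℝ f x (d + s • d₀)).tendsto 0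
      rw [zero_smul, add_zero] at this
      exact this.mono_left nhdsWithin_le_nhds
    refine le_of_tendsto hlim ?_
    filter_upwards [self_mem_nhdsWithin] with s (hs : 0 < s)
    refine hstrict _ fun k hk => ?_
    obtain ⟨h1, h2⟩ := hd₀ k hk
    have h3 := hd k hk
    rw [map_add, map_smul, smul_eq_mul]
    refine ⟨by positivity, h2.imp (fun h2 => by positivity) id⟩
  obtain ⟨lam, hlam, hsum⟩ := farkas (Finset.univ.filter fun k => g k x = 0)
    (fun k => fderiv ℝ (g k) x) (-fderiv ℝ f x) (fun d hd => by
      have := hcone d fun k hk => hd k (by simpa using hk)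
      simpa using this)
  refine ⟨fun k => if g k x = 0 then lam k else 0, fun k => ?_, fun k => ?_, ?_⟩
  · dsimp only
    split_ifs
    exacts [hlam k, le_rfl]
  · dsimp only
    split_ifs with h
    · rw [h, mul_zero]
    · rw [zero_mul]
  · rw [Finset.sum_filter] at hsum
    simp only [ite_smul, zero_smul]
    rw [← hsum, add_neg_cancel]

/-! ### Derivatives of the objective and of the constraints -/

theorem fderiv_apply_eq_of_hasDerivAt {E : Type*} [NormedAddCommGroup E] [NormedSpace ℝ E]
    {f : E → ℝ} {x d : E} {a : ℝ} (hf : DifferentiableAt ℝ f x)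
    (h : HasDerivAt (fun s : ℝ => f (x + s • d)) a 0) : fderiv ℝ f x d = a :=
  (hf.hasFDerivAt.hasLineDerivAt d).unique h

theorem fderiv_apply_eq_of_quadratic {E : Type*} [NormedAddCommGroup E] [NormedSpace ℝ E]
    {f : E → ℝ} {x d : E} {a b : ℝ} (hf : DifferentiableAt ℝ f x)
    (h : ∀ s : ℝ, f (x + s • d) = f x + s * a + s ^ 2 * b) : fderiv ℝ f x d = a := by
  refine fderiv_apply_eq_of_hasDerivAt hf ?_
  simp only [h]
  have := (((hasDerivAt_id (0 : ℝ)).mul_const a).const_add (f x)).add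
    ((hasDerivAt_pow 2 (0 : ℝ)).mul_const b)
  refine this.congr_deriv ?_
  simp

theorem al_mk {M : ℕ} (a b : Fin (M + 1) → ℝ) (c : Fin M → ℝ) : Var.al (a, b, c) = a := rfl

theorem t_mk {M : ℕ} (a b : Fin (M + 1) → ℝ) (c : Fin M → ℝ) : Var.t (a, b, c) = b := rfl

theorem z_mk {M : ℕ} (a b : Fin (M + 1) → ℝ) (c : Fin M → ℝ) : Var.z (a, b, c) = c := rfl

theorem al_add_smul {M : ℕ} (x d : Var M) (s : ℝ) : (x + s • d).al = x.al + s • d.al := rfl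

theorem t_add_smul {M : ℕ} (x d : Var M) (s : ℝ) (i : Fin (M + 1)) :
    (x + s • d).t i = x.t i + s * d.t i := rfl

theorem z_add_smul {M : ℕ} (x d : Var M) (s : ℝ) (i : Fin M) :
    (x + s • d).z i = x.z i + s * d.z i := rfl

theorem differentiable_objective {M : ℕ} : Differentiable ℝ (objective (M := M)) := by
  unfold objective
  fun_prop

theorem differentiable_slackObjective {M : ℕ} : Differentiable ℝ (slackObjective (M := M)) := by
  unfold slackObjective
  fun_prop

theorem hasDerivAt_prod_add_mul {ι : Type*} [Fintype ι] [DecidableEq ι] (t d : ι → ℝ) :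
    HasDerivAt (fun s : ℝ => ∏ i, (t i + s * d i)) (∑ i, (∏ j ∈ Finset.univ.erase i, t j) * d i)
      0 := by
  have := HasDerivAt.fun_finsetProd (u := Finset.univ) (f := fun i (s : ℝ) => t i + s * d i)
    (f' := d) (x := 0) fun i _ => by
      simpa using ((hasDerivAt_id (0 : ℝ)).mul_const (d i)).const_add (t i)
  simpa using this

theorem fderiv_objective_apply {M : ℕ} (x d : Var M) :
    fderiv ℝ objective x d = ∑ i, (∏ j ∈ Finset.univ.erase i, x.t j) * d.t i :=
  fderiv_apply_eq_of_hasDerivAt (differentiable_objective x) (hasDerivAt_prod_add_mul x.t d.t)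

theorem fderiv_slackObjective_apply {M : ℕ} (y d : (Fin (M + 1) → ℝ) × (Fin (M + 1) → ℝ)) :
    fderiv ℝ slackObjective y d = ∑ i, (∏ j ∈ Finset.univ.erase i, y.2 j) * d.2 i :=
  fderiv_apply_eq_of_hasDerivAt (differentiable_slackObjective y) (hasDerivAt_prod_add_mul y.2 d.2)

theorem sum_splitIdx {M : ℕ} {A : Type*} [AddCommMonoid A] (f : SplitIdx M → A) :
    ∑ k, f k = (∑ i, f (.interf i) + ∑ i, f (.product i)) + (f .last + ∑ k, f (.alloc k)) := by
  let e : (Fin M ⊕ Fin M) ⊕ (Unit ⊕ AllocIdx M) ≃ SplitIdx M :=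
    { toFun := Sum.elim (Sum.elim .interf .product) (Sum.elim (fun _ => .last) .alloc)
      invFun := fun
        | .interf i => .inl (.inl i)
        | .product i => .inl (.inr i)
        | .last => .inr (.inl ())
        | .alloc k => .inr (.inr k)
      left_inv := by rintro ((i | i) | (i | i)) <;> rfl
      right_inv := by rintro (i | i | _ | k) <;> rfl }
  rw [← e.sum_comp]
  simp [e, Fintype.sum_sum_type]

theorem sum_slackIdx {M : ℕ} {A : Type*} [AddCommMonoid A] (f : SlackIdx M → A) :
    ∑ k, f k = ∑ i, f (.rate i) + ∑ k, f (.alloc k) := by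
  let e : Fin (M + 1) ⊕ AllocIdx M ≃ SlackIdx M :=
    { toFun := Sum.elim .rate .alloc
      invFun := fun
        | .rate i => .inl i
        | .alloc k => .inr k
      left_inv := by rintro (i | i) <;> rfl
      right_inv := by rintro (i | k) <;> rfl }
  rw [← e.sum_comp]
  simp [e, Fintype.sum_sum_type]

namespace Network

variable {N M : ℕ} (net : Network N M)

/-- The linear part of `interf`. -/
def interfLin (d : Fin (M + 1) → ℝ) (i : Fin (M + 1)) : ℝ :=
  ∑ j ∈ Finset.Ioi i, d j * net.gain i

/-- The linear part of `allocCon`. -/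
def allocLin : AllocIdx M → (Fin (M + 1) → ℝ) → ℝ
  | .qos i, d => d i * net.gain i - ((2 : ℝ) ^ net.Rbar i - 1) * net.interfLin d i
  | .order i, d => d i.castSucc - d i.succ
  | .power, d => -∑ i, d i

/-- The derivative of `convexCon r` at `x` in direction `d`. -/
def convexLin (r x : Var M) : SplitIdx M → Var M → ℝ
  | .interf i, d => d.z i - net.interfLin d.al i.castSucc
  | .product i, d =>
      d.al i.castSucc * net.gain i.castSucc -
        ((x.z i + x.t i.castSucc) / 2 * (d.z i + d.t i.castSucc) - d.z i -
          (r.z i - r.t i.castSucc) / 2 * (d.z i - d.t i.castSucc))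
  | .last, d => d.al (Fin.last M) * net.gain (Fin.last M) - d.t (Fin.last M)
  | .alloc k, d => net.allocLin k d.al

/-- The quadratic part of the constraints of the convex program, with the sign changed. -/
def curv : SplitIdx M → Var M → ℝ
  | .product i, d => (d.z i + d.t i.castSucc) ^ 2 / 4
  | _, _ => 0

theorem curv_nonneg (k : SplitIdx M) (d : Var M) : 0 ≤ curv k d := by
  cases k <;> simp only [curv] <;> positivity

theorem interf_add_smul (al d : Fin (M + 1) → ℝ) (s : ℝ) (i : Fin (M + 1)) :
    net.interf (al + s • d) i = net.interf al i + s * net.interfLin d i := by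
  simp only [interf, interfLin, Finset.mul_sum, Pi.add_apply, Pi.smul_apply, smul_eq_mul, add_mul,
    Finset.sum_add_distrib, mul_assoc]
  ring

theorem allocCon_add_smul (k : AllocIdx M) (al d : Fin (M + 1) → ℝ) (s : ℝ) :
    net.allocCon k (al + s • d) = net.allocCon k al + s * net.allocLin k d := by
  cases k with
  | qos i =>
    simp only [allocCon, allocLin, interf_add_smul, Pi.add_apply, Pi.smul_apply, smul_eq_mul]
    ring
  | order i =>
    simp only [allocCon, allocLin, Pi.add_apply, Pi.smul_apply, smul_eq_mul]
    ring
  | power =>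
    simp only [allocCon, allocLin, Pi.add_apply, Pi.smul_apply, smul_eq_mul,
      Finset.sum_add_distrib, ← Finset.mul_sum]
    ring

/-- This exact second-order expansion yields the derivatives, the concavity along segments, and the
affinity of all constraints other than the products. -/
theorem convexCon_add_smul (r x d : Var M) (k : SplitIdx M) (s : ℝ) :
    net.convexCon r k (x + s • d) =
      net.convexCon r k x + s * net.convexLin r x k d - s ^ 2 * curv k d := by
  cases k with
  | interf i =>
    simp only [convexCon, convexLin, curv, al_add_smul, z_add_smul, interf_add_smul]
    ring
  | product i =>
    simp only [convexCon, convexLin, curv, al_add_smul, t_add_smul, z_add_smul,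
      Pi.add_apply, Pi.smul_apply, smul_eq_mul]
    ring
  | last =>
    simp only [convexCon, convexLin, curv, al_add_smul, t_add_smul,
      Pi.add_apply, Pi.smul_apply, smul_eq_mul]
    ring
  | alloc k =>
    simp only [convexCon, convexLin, curv, al_add_smul, allocCon_add_smul]
    ring

/-- The subtracted term is the gap between the square `(z - t)²` and its tangent at `r`, divided by
four. -/
theorem convexCon_eq_splitCon_sub (r x : Var M) (k : SplitIdx M) :
    net.convexCon r k x = net.splitCon k x - match k with
      | .product i => ((x.z i - x.t i.castSucc) - (r.z i - r.t i.castSucc)) ^ 2 / 4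
      | _ => 0 := by
  cases k <;> simp only [convexCon, splitCon] <;> ring

theorem convexCon_self (x : Var M) (k : SplitIdx M) : net.convexCon x k x = net.splitCon k x := by
  rw [convexCon_eq_splitCon_sub]
  cases k <;> simp

theorem convexCon_le_splitCon (r x : Var M) (k : SplitIdx M) :
    net.convexCon r k x ≤ net.splitCon k x := by
  rw [convexCon_eq_splitCon_sub, sub_le_self_iff]
  cases k <;> positivity

/-- The linear term is that of the convex program with reference point `x` itself, which is why
multipliers can be transferred. -/
theorem splitCon_add_smul (x d : Var M) (k : SplitIdx M) : ∃ b : ℝ, ∀ s : ℝ,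
    net.splitCon k (x + s • d) = net.splitCon k x + s * net.convexLin x x k d + s ^ 2 * b := by
  cases k with
  | product i =>
    refine ⟨-(d.z i * d.t i.castSucc), fun s => ?_⟩
    simp only [splitCon, convexLin, al_add_smul, t_add_smul, z_add_smul,
      Pi.add_apply, Pi.smul_apply, smul_eq_mul]
    ring
  | interf i => exact ⟨0, fun s =>
      (net.convexCon_add_smul x x d (.interf i) s).trans (by simp [curv]; rfl)⟩
  | last => exact ⟨0, fun s => (net.convexCon_add_smul x x d .last s).trans (by simp [curv]; rfl)⟩
  | alloc k => exact ⟨0, fun s =>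
      (net.convexCon_add_smul x x d (.alloc k) s).trans (by simp [curv]; rfl)⟩

theorem differentiable_interf (i : Fin (M + 1)) :
    Differentiable ℝ fun al : Fin (M + 1) → ℝ => net.interf al i := by
  unfold interf
  fun_prop

theorem differentiable_allocCon (k : AllocIdx M) : Differentiable ℝ (net.allocCon k) := by
  have := net.differentiable_interf
  cases k <;> unfold allocCon <;> fun_prop

theorem differentiable_convexCon (r : Var M) (k : SplitIdx M) :
    Differentiable ℝ (net.convexCon r k) := by
  have h1 := net.differentiable_interf
  have h2 := net.differentiable_allocCon
  cases k <;> unfold convexCon <;> fun_prop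

theorem differentiable_splitCon (k : SplitIdx M) : Differentiable ℝ (net.splitCon k) := by
  have h1 := net.differentiable_interf
  have h2 := net.differentiable_allocCon
  cases k <;> unfold splitCon <;> fun_prop

theorem fderiv_convexCon_apply (r x d : Var M) (k : SplitIdx M) :
    fderiv ℝ (net.convexCon r k) x d = net.convexLin r x k d :=
  fderiv_apply_eq_of_quadratic (b := -curv k d) (net.differentiable_convexCon r k x) fun s => by
    rw [convexCon_add_smul]; ring

theorem fderiv_splitCon_apply (x d : Var M) (k : SplitIdx M) :
    fderiv ℝ (net.splitCon k) x d = net.convexLin x x k d :=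
  fderiv_apply_eq_of_quadratic (net.differentiable_splitCon k x)
    (net.splitCon_add_smul x d k).choose_spec

/-- Concavity: the defect is `s (1 - s)` times the nonnegative `curv`. -/
theorem le_convexCon_segment (r x y : Var M) (k : SplitIdx M) {s : ℝ} (hs0 : 0 ≤ s) (hs1 : s ≤ 1) :
    (1 - s) * net.convexCon r k x + s * net.convexCon r k y ≤
      net.convexCon r k (x + s • (y - x)) := by
  have h1 := net.convexCon_add_smul r x (y - x) k s
  have h2 := net.convexCon_add_smul r x (y - x) k 1
  rw [one_smul, add_sub_cancel] at h2
  have h3 : 0 ≤ s * (1 - s) * curv k (y - x) :=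
    mul_nonneg (mul_nonneg hs0 (by linarith)) (curv_nonneg k _)
  rw [h1, h2]
  linarith

/-! ### Bounds on feasible points -/

theorem gain_pos (i : Fin (M + 1)) : 0 < net.gain i := by
  have h1 := net.rho_pos
  have h2 := net.snr_pos
  have h3 := norm_pos_iff.mpr net.hps_ne
  have h4 := norm_pos_iff.mpr (net.h_ne i)
  unfold gain
  positivity

theorem two_rpow_sub_one_nonneg (i : Fin (M + 1)) : 0 ≤ (2 : ℝ) ^ net.Rbar i - 1 :=
  sub_nonneg.mpr (Real.one_le_rpow (by norm_num) (net.Rbar_nonneg i))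

theorem interf_last (al : Fin (M + 1) → ℝ) : net.interf al (Fin.last M) = 1 := by
  have : Finset.Ioi (Fin.last M) = ∅ := by
    ext j
    simp [Fin.le_last]
  simp [interf, this]

theorem interfLin_last (d : Fin (M + 1) → ℝ) : net.interfLin d (Fin.last M) = 0 := by
  have : Finset.Ioi (Fin.last M) = ∅ := by
    ext j
    simp [Fin.le_last]
  simp [interfLin, this]

theorem convexFeasible_subset (r : Var M) : net.convexFeasible r ⊆ net.splitFeasible :=
  fun x hx => ⟨hx.1, fun k => (hx.2 k).trans (net.convexCon_le_splitCon r x k)⟩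

theorem mem_convexFeasible_self {x : Var M} (hx : x ∈ net.splitFeasible) :
    x ∈ net.convexFeasible x :=
  ⟨hx.1, fun k => (net.convexCon_self x k).symm ▸ hx.2 k⟩

variable {net}

/-- Receiver `M` sees no interference, so its rate constraint gives `α_M ≥ 0`; the ordering carries
this to the others. -/
theorem al_nonneg {al : Fin (M + 1) → ℝ} (h : ∀ k, 0 ≤ net.allocCon k al) (i : Fin (M + 1)) :
    0 ≤ al i := by
  have hanti : Antitone al := Fin.antitone_iff_succ_le.mpr fun j => by
    have := h (.order j)
    simp only [allocCon] at this
    linarith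
  have hlast : 0 ≤ al (Fin.last M) := by
    have h1 := h (.qos (Fin.last M))
    simp only [allocCon, interf_last] at h1
    have h2 := net.two_rpow_sub_one_nonneg (Fin.last M)
    exact nonneg_of_mul_nonneg_left (by linarith) (net.gain_pos (Fin.last M))
  exact hlast.trans (hanti (Fin.le_last i))

theorem one_le_interf {al : Fin (M + 1) → ℝ} (h : ∀ k, 0 ≤ net.allocCon k al) (i : Fin (M + 1)) :
    1 ≤ net.interf al i := by
  have : 0 ≤ ∑ j ∈ Finset.Ioi i, al j * net.gain i :=
    Finset.sum_nonneg fun j _ => mul_nonneg (al_nonneg h j) (net.gain_pos i).le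
  simp only [interf]
  linarith

theorem al_le_one {al : Fin (M + 1) → ℝ} (h : ∀ k, 0 ≤ net.allocCon k al) (i : Fin (M + 1)) :
    al i ≤ 1 := by
  have h1 := h .power
  simp only [allocCon] at h1
  have h2 := Finset.single_le_sum (f := al) (fun j _ => al_nonneg h j) (Finset.mem_univ i)
  linarith

theorem al_mul_gain_le {al : Fin (M + 1) → ℝ} (h : ∀ k, 0 ≤ net.allocCon k al)
    (i : Fin (M + 1)) : al i * net.gain i ≤ net.gain i :=
  mul_le_of_le_one_left (net.gain_pos i).le (al_le_one h i)

theorem interf_le {al : Fin (M + 1) → ℝ} (h : ∀ k, 0 ≤ net.allocCon k al) (i : Fin (M + 1)) :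
    net.interf al i ≤ net.gain i + 1 := by
  have h1 := h .power
  simp only [allocCon] at h1
  have h2 : ∑ j ∈ Finset.Ioi i, al j ≤ ∑ j, al j :=
    Finset.sum_le_sum_of_subset_of_nonneg (Finset.subset_univ _) fun j _ _ => al_nonneg h j
  simp only [interf, ← Finset.sum_mul]
  have := mul_le_of_le_one_left (net.gain_pos i).le (by linarith : ∑ j ∈ Finset.Ioi i, al j ≤ 1)
  linarith

theorem alloc_of_mem {x : Var M} (hx : x ∈ net.splitFeasible) (k : AllocIdx M) :
    0 ≤ net.allocCon k x.al :=
  hx.2 (.alloc k)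

theorem interf_le_z {x : Var M} (hx : x ∈ net.splitFeasible) (i : Fin M) :
    net.interf x.al i.castSucc ≤ x.z i :=
  sub_nonneg.mp (hx.2 (.interf i))

theorem one_le_z {x : Var M} (hx : x ∈ net.splitFeasible) (i : Fin M) : 1 ≤ x.z i :=
  (one_le_interf (alloc_of_mem hx) _).trans (interf_le_z hx i)

theorem z_mul_le {x : Var M} (hx : x ∈ net.splitFeasible) (i : Fin M) :
    x.z i * (x.t i.castSucc - 1) ≤ x.al i.castSucc * net.gain i.castSucc := by
  have := hx.2 (.product i)
  simp only [splitCon] at this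
  linarith

theorem t_last_le {x : Var M} (hx : x ∈ net.splitFeasible) :
    x.t (Fin.last M) - 1 ≤ x.al (Fin.last M) * net.gain (Fin.last M) :=
  sub_nonneg.mp (hx.2 .last)

/-- Replacing `z_i` by the smaller interference is legitimate for `t_i ≥ 1`; for `t_i ≤ 1` the left
side is nonpositive. -/
theorem t_sub_one_mul_interf_le {x : Var M} (hx : x ∈ net.splitFeasible) (i : Fin (M + 1)) :
    (x.t i - 1) * net.interf x.al i ≤ x.al i * net.gain i := by
  have ha : 0 ≤ x.al i * net.gain i :=
    mul_nonneg (al_nonneg (alloc_of_mem hx) i) (net.gain_pos i).le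
  have hI := one_le_interf (alloc_of_mem hx) i
  rcases le_total (x.t i) 1 with h | h
  · exact (mul_nonpos_of_nonpos_of_nonneg (by linarith) (by linarith)).trans ha
  · induction i using Fin.lastCases with
    | last => simpa [interf_last] using t_last_le hx
    | cast i =>
      refine le_trans ?_ (z_mul_le hx i)
      rw [mul_comm]
      exact mul_le_mul_of_nonneg_right (interf_le_z hx i) (by linarith)

theorem t_le {x : Var M} (hx : x ∈ net.splitFeasible) (i : Fin (M + 1)) :
    x.t i ≤ net.gain i + 1 := by
  have h1 := t_sub_one_mul_interf_le hx i
  have h2 := al_mul_gain_le (alloc_of_mem hx) i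
  have h3 := net.gain_pos i
  have h4 := one_le_interf (alloc_of_mem hx) i
  by_contra! hcon
  have : (x.t i - 1) * 1 ≤ (x.t i - 1) * net.interf x.al i :=
    mul_le_mul_of_nonneg_left h4 (by linarith)
  linarith

theorem slackFeasible_of_mem {x : Var M} (hx : x ∈ net.splitFeasible) :
    (x.al, x.t) ∈ net.slackFeasible := by
  refine ⟨hx.1, fun k => ?_⟩
  cases k with
  | rate i =>
    have hI := one_le_interf (alloc_of_mem hx) i
    simp only [slackCon, sinr, sub_nonneg]
    rw [le_div_iff₀ (by linarith)]
    exact t_sub_one_mul_interf_le hx i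
  | alloc k => exact alloc_of_mem hx k

/-! ### Solvability of the convex programs -/

/-- The product constraint bounds `(z + t)²` by an affine function of `z + t`. The constant is
generous: `5` exceeds the `4` in that function, and `4 c²` is slack. -/
theorem z_le_of_mem_convexFeasible {r x : Var M} (hx : x ∈ net.convexFeasible r) (i : Fin M) :
    x.z i ≤ 5 + 2 * |r.z i - r.t i.castSucc| + 4 * net.gain i.castSucc +
      4 * (r.z i - r.t i.castSucc) ^ 2 := by
  have hs := net.convexFeasible_subset r hx
  have h1 := hx.2 (.product i)
  simp only [convexCon] at h1
  have h2 := al_mul_gain_le (alloc_of_mem hs) i.castSucc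
  have h3 := one_le_z hs i
  have h4 := hx.1 i.castSucc
  have h5 := net.gain_pos i.castSucc
  set c := r.z i - r.t i.castSucc
  set g := net.gain i.castSucc
  set z := x.z i
  set t := x.t i.castSucc
  have h6 : c * (z - t) ≤ |c| * (z + t) := by
    refine (le_abs_self _).trans ?_
    rw [abs_mul]
    exact mul_le_mul_of_nonneg_left (abs_le.mpr ⟨by linarith, by linarith⟩) (abs_nonneg c)
  have h7 : (z + t) ^ 2 ≤ 4 * g + (4 + 2 * |c|) * (z + t) := by
    have : c * (z - r.z i - t + r.t i.castSucc) = c * (z - t) - c ^ 2 := by ring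
    have := sq_nonneg c
    linarith
  by_contra! hcon
  have h8 : 0 ≤ |c| := abs_nonneg c
  have h9 : (5 + 2 * |c| + 4 * g + 4 * c ^ 2) * (z + t) ≤ (z + t) ^ 2 := by
    rw [sq (z + t)]
    exact mul_le_mul_of_nonneg_right (by linarith) (by linarith)
  have h10 : 4 * g * 1 ≤ 4 * g * (z + t) := mul_le_mul_of_nonneg_left (by linarith) (by linarith)
  have h11 : 0 ≤ 4 * c ^ 2 * (z + t) := mul_nonneg (by positivity) (by linarith)
  linarith

theorem isCompact_convexFeasible (r : Var M) : IsCompact (net.convexFeasible r) := by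
  have hclosed : IsClosed (net.convexFeasible r) := by
    have h1 : IsClosed {x : Var M | ∀ i, 0 ≤ x.t i} := by
      simp only [Set.ofPred_forall]
      exact isClosed_iInter fun i => isClosed_le continuous_const (by fun_prop)
    have h2 : IsClosed {x : Var M | ∀ k, 0 ≤ net.convexCon r k x} := by
      simp only [Set.ofPred_forall]
      exact isClosed_iInter fun k =>
        isClosed_le continuous_const (net.differentiable_convexCon r k).continuous
    exact h1.inter h2
  refine IsCompact.of_isClosed_subset (isCompact_Icc (a := (0 : Var M))
    (b := (fun _ => 1, fun i => net.gain i + 1, fun i => 5 + 2 * |r.z i - r.t i.castSucc| +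
      4 * net.gain i.castSucc + 4 * (r.z i - r.t i.castSucc) ^ 2))) hclosed fun x hx => ?_
  have hs := net.convexFeasible_subset r hx
  exact ⟨⟨fun i => al_nonneg (alloc_of_mem hs) i, fun i => hx.1 i,
      fun i => zero_le_one.trans (one_le_z hs i)⟩,
    ⟨fun i => al_le_one (alloc_of_mem hs) i, fun i => t_le hs i,
      fun i => z_le_of_mem_convexFeasible hx i⟩⟩

theorem exists_isMaxOn_convexFeasible {r : Var M} (hr : r ∈ net.splitFeasible) :
    ∃ x ∈ net.convexFeasible r, IsMaxOn objective (net.convexFeasible r) x :=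
  (isCompact_convexFeasible r).exists_isMaxOn ⟨r, net.mem_convexFeasible_self hr⟩
    differentiable_objective.continuous.continuousOn

theorem exists_isRun {x₀ : Var M} (hx₀ : x₀ ∈ net.splitFeasible) :
    ∃ x : ℕ → Var M, net.IsRun x ∧ x 0 = x₀ := by
  choose! step hstep hmax using fun r (hr : r ∈ net.splitFeasible) =>
    exists_isMaxOn_convexFeasible hr
  have hfeas : ∀ τ, step^[τ] x₀ ∈ net.splitFeasible := fun τ => by
    induction τ with
    | zero => exact hx₀
    | succ τ ih =>
      rw [Function.iterate_succ_apply']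
      exact net.convexFeasible_subset _ (hstep _ ih)
  refine ⟨fun τ => step^[τ] x₀, ⟨hx₀, fun τ => ?_⟩, rfl⟩
  simp only [Function.iterate_succ_apply']
  exact ⟨hstep _ (hfeas τ), hmax _ (hfeas τ)⟩

/-! ### Strictly feasible points and the KKT conditions of the convex programs -/

theorem exists_strictly_feasible {r : Var M} (hr : r ∈ net.splitFeasible) :
    ∃ s ∈ net.convexFeasible r, (∀ i, 0 < s.t i) ∧ ∀ i, 0 < net.convexCon r (.product i) s := by
  -- At `t = 1/2` the product constraint of (Q) has value at least `z / 2 > 0`. Moving a fraction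
  -- `δ` of the way there gains to first order in `δ` and loses only `δ² (1/2 - t)² / 4`; this `δ`
  -- keeps the loss smaller (`hδ2`).
  set δ : Fin (M + 1) → ℝ := fun i => 1 / (1 + r.t i ^ 2) with hδ
  have hδ0 : ∀ i, 0 < δ i := fun i => by simp only [hδ]; positivity
  have hδ1 : ∀ i, δ i ≤ 1 := fun i => by
    simp only [hδ]
    rw [div_le_one (by positivity)]
    nlinarith [sq_nonneg (r.t i)]
  have hδ2 : ∀ i, δ i * (1 / 2 - r.t i) ^ 2 < 2 := fun i => by
    simp only [hδ]
    rw [one_div, inv_mul_lt_iff₀ (by positivity)]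
    nlinarith [hr.1 i, sq_nonneg (r.t i)]
  set s : Var M := (r.al, fun i => (1 - δ i) * r.t i + δ i / 2, r.z) with hs
  have hst : ∀ i, 0 < s.t i := fun i => by
    have h1 := mul_nonneg (sub_nonneg.mpr (hδ1 i)) (hr.1 i)
    have h2 := hδ0 i
    change 0 < (1 - δ i) * r.t i + δ i / 2
    linarith
  have ha : ∀ i, 0 ≤ r.al i * net.gain i := fun i =>
    mul_nonneg (al_nonneg (alloc_of_mem hr) i) (net.gain_pos i).le
  have hprod : ∀ i, 0 < net.convexCon r (.product i) s := fun i => by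
    have h1 := z_mul_le hr i
    have h2 := one_le_z hr i
    have h3 := hδ0 i.castSucc
    have h4 := hδ1 i.castSucc
    have h5 := hδ2 i.castSucc
    have h6 := ha i.castSucc
    simp only [convexCon, hs]
    set d := δ i.castSucc
    set t := r.t i.castSucc
    set z := r.z i
    set a := r.al i.castSucc * net.gain i.castSucc
    have e : a - (1 / 4 * (z + ((1 - d) * t + d / 2)) ^ 2 - z - 1 / 4 * ((z - t) ^ 2 +
        2 * (z - t) * (z - z - ((1 - d) * t + d / 2) + t))) =
        (1 - d) * (a - z * (t - 1)) + d * a + d / 2 * (z - 1) +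
          d / 4 * (2 - d * (1 / 2 - t) ^ 2) := by ring
    rw [e]
    have p1 : 0 ≤ (1 - d) * (a - z * (t - 1)) := mul_nonneg (by linarith) (by linarith)
    have p2 : 0 ≤ d * a := mul_nonneg h3.le h6
    have p3 : 0 ≤ d / 2 * (z - 1) := mul_nonneg (by linarith) (by linarith)
    have p4 : 0 < d / 4 * (2 - d * (1 / 2 - t) ^ 2) := mul_pos (by linarith) (by linarith)
    linarith
  refine ⟨s, ⟨fun i => (hst i).le, fun k => ?_⟩, hst, hprod⟩
  cases k with
  | product i => exact (hprod i).le
  | interf i => exact hr.2 (.interf i)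
  | alloc k => exact hr.2 (.alloc k)
  | last =>
    have h1 := t_last_le hr
    have h2 := ha (Fin.last M)
    have h3 := hδ0 (Fin.last M)
    have h4 := mul_nonneg (sub_nonneg.mpr (hδ1 (Fin.last M)))
      (sub_nonneg.mpr h1)
    have h5 := mul_nonneg h3.le h2
    change 0 ≤ r.al (Fin.last M) * net.gain (Fin.last M) -
      ((1 - δ (Fin.last M)) * r.t (Fin.last M) + δ (Fin.last M) / 2 - 1)
    linarith

theorem objective_pos {x : Var M} (h : ∀ i, 0 < x.t i) : 0 < objective x :=
  Finset.prod_pos fun i _ => h i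

theorem t_pos_of_objective_pos {x : Var M} (h : ∀ i, 0 ≤ x.t i) (hx : 0 < objective x)
    (i : Fin (M + 1)) : 0 < x.t i :=
  (h i).lt_of_ne' (Finset.prod_ne_zero_iff.mp hx.ne' i (Finset.mem_univ i))

/-- Some feasible point has positive objective, so no factor vanishes at an optimum. -/
theorem t_pos_of_isMaxOn {r x : Var M} (hr : r ∈ net.splitFeasible)
    (hx : x ∈ net.convexFeasible r) (hmax : IsMaxOn objective (net.convexFeasible r) x)
    (i : Fin (M + 1)) : 0 < x.t i := by
  obtain ⟨s, hs, hst, -⟩ := exists_strictly_feasible hr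
  exact t_pos_of_objective_pos hx.1 ((objective_pos hst).trans_le (hmax hs)) i

theorem isKKT_of_isMaxOn {r x : Var M} (hr : r ∈ net.splitFeasible)
    (hx : x ∈ net.convexFeasible r) (hmax : IsMaxOn objective (net.convexFeasible r) x) :
    IsKKT objective (net.convexCon r) x := by
  obtain ⟨s, hs, -, hsprod⟩ := exists_strictly_feasible hr
  -- The domain condition `t ≥ 0` carries no multiplier; it is inactive near `x`.
  have htpos : ∀ᶠ y : Var M in 𝓝 x, ∀ i, 0 < y.t i :=
    eventually_all.mpr fun i => (by fun_prop : Continuous fun y : Var M => y.t i).continuousAt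
      |>.eventually_const_lt (t_pos_of_isMaxOn hr hx hmax i)
  refine isKKT_of_eventually_le (d₀ := s - x) (differentiable_objective x)
    (fun k => net.differentiable_convexCon r k x) hx.2 ?_ fun k hk => ?_
  · filter_upwards [htpos] with y hy hyk using hmax ⟨fun i => (hy i).le, hyk⟩
  -- For an active constraint, concavity makes the derivative towards `s` at least the constraint
  -- value at `s`, which is positive for the products.
  · have h1 := net.convexCon_add_smul r x (s - x) k 1
    rw [one_smul, add_sub_cancel, hk] at h1
    have h2 := curv_nonneg k (s - x)
    have h3 := hs.2 k
    simp only [fderiv_convexCon_apply]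
    refine ⟨by linarith, ?_⟩
    cases k with
    | product i =>
      have := hsprod i
      exact .inl (by linarith)
    | interf i | last | alloc k =>
      refine .inr fun u d => ?_
      rw [convexCon_add_smul]
      simp [curv]

/-! ### Boundedness of the iterates -/

theorem stationarity_apply {r x : Var M} {lam : SplitIdx M → ℝ}
    (h : fderiv ℝ objective x + ∑ k, lam k • fderiv ℝ (net.convexCon r k) x = 0) (d : Var M) :
    ∑ i, (∏ j ∈ Finset.univ.erase i, x.t j) * d.t i + ∑ k, lam k * net.convexLin r x k d = 0 := by
  have := DFunLike.congr_fun h d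
  simpa only [add_apply, sum_apply, FunLike.coe_smul, Pi.smul_apply, smul_eq_mul,
    fderiv_objective_apply, fderiv_convexCon_apply, zero_apply] using this

/-- Stationarity tested on the coordinate direction of `t_i`. -/
theorem prod_eq_of_stationarity {r x : Var M} {lam : SplitIdx M → ℝ}
    (h : fderiv ℝ objective x + ∑ k, lam k • fderiv ℝ (net.convexCon r k) x = 0) (i : Fin M) :
    ∏ j ∈ Finset.univ.erase i.castSucc, x.t j =
      lam (.product i) * ((x.z i + x.t i.castSucc + (r.z i - r.t i.castSucc)) / 2) := by
  have h1 := stationarity_apply h (0, Pi.single i.castSucc 1, 0)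
  rw [Finset.sum_eq_single i.castSucc (fun j _ hj => by simp [t_mk, hj]) (by simp),
    Finset.sum_eq_single (.product i : SplitIdx M) (fun k _ hk => ?_) (by simp)] at h1
  · simp [convexLin, al_mk, t_mk, z_mk] at h1 ⊢
    linarith
  · cases k with
    | product j =>
      have hj : j ≠ i := fun e => hk (by rw [e])
      simp [convexLin, al_mk, t_mk, z_mk, hj]
    | interf j => simp [convexLin, al_mk, z_mk, interfLin]
    | last => simp [convexLin, al_mk, t_mk, (Fin.castSucc_lt_last i).ne]
    | alloc k => cases k <;> simp [convexLin, al_mk, allocLin, interfLin]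

/-- Stationarity tested on the coordinate direction of `z_i`, which the objective does not involve.
-/
theorem multiplier_eq_of_stationarity {r x : Var M} {lam : SplitIdx M → ℝ}
    (h : fderiv ℝ objective x + ∑ k, lam k • fderiv ℝ (net.convexCon r k) x = 0) (i : Fin M) :
    lam (.interf i) =
      lam (.product i) * ((x.z i + x.t i.castSucc - (r.z i - r.t i.castSucc)) / 2 - 1) := by
  have h1 := stationarity_apply h (0, 0, Pi.single i 1)
  rw [sum_splitIdx, Finset.sum_eq_single i
      (fun j _ hj => by simp [convexLin, al_mk, z_mk, interfLin, hj])
      (by simp), Finset.sum_eq_single i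
      (fun j _ hj => by simp [convexLin, al_mk, t_mk, z_mk, hj]) (by simp)] at h1
  have h2 : ∀ k, net.convexLin r x (.alloc k) (0, 0, Pi.single i 1) = 0 := fun k => by
    cases k <;> simp [convexLin, al_mk, allocLin, interfLin]
  simp only [h2] at h1
  simp [convexLin, al_mk, t_mk, z_mk, interfLin] at h1
  linarith

theorem multiplier_pos_of_stationarity {r x : Var M} {lam : SplitIdx M → ℝ}
    (h : fderiv ℝ objective x + ∑ k, lam k • fderiv ℝ (net.convexCon r k) x = 0)
    (hlam : ∀ k, 0 ≤ lam k) (ht : ∀ i, 0 < x.t i) (i : Fin M) : 0 < lam (.product i) := by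
  have h1 := prod_eq_of_stationarity h i
  have h2 : 0 < ∏ j ∈ Finset.univ.erase i.castSucc, x.t j := Finset.prod_pos fun j _ => ht j
  refine (hlam _).lt_of_ne' fun h0 => ?_
  rw [h0, zero_mul] at h1
  linarith

/-- The product multiplier is positive, so that constraint is tight. If the interference constraint
is slack, its multiplier vanishes and stationarity in `z_i` gives the recursion; inserting it into
the tight constraint gives `(t - 1)(z + t - 1) = α g ≥ 0`, hence `t ≥ 1`. -/
theorem z_eq_of_isKKT {r x : Var M} (hx : x ∈ net.convexFeasible r) (ht : ∀ i, 0 < x.t i)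
    (hkkt : IsKKT objective (net.convexCon r) x) (i : Fin M) :
    x.z i = net.interf x.al i.castSucc ∨
      (1 ≤ x.t i.castSucc ∧ x.z i = r.z i + 2 - x.t i.castSucc - r.t i.castSucc) := by
  obtain ⟨-, -, -, lam, hlam, hcomp, hstat⟩ := hkkt
  have hs := net.convexFeasible_subset r hx
  have hpos := multiplier_pos_of_stationarity hstat hlam ht i
  have hmul := multiplier_eq_of_stationarity hstat i
  have hc1 := hcomp (.interf i)
  have hc2 := (mul_eq_zero.mp (hcomp (.product i))).resolve_left hpos.ne'
  rcases mul_eq_zero.mp hc1 with h0 | h0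
  · right
    have hz : x.z i = r.z i + 2 - x.t i.castSucc - r.t i.castSucc := by
      rw [h0] at hmul
      have := (mul_eq_zero.mp hmul.symm).resolve_left hpos.ne'
      linarith
    refine ⟨?_, hz⟩
    have h1 := one_le_z hs i
    have h2 := ht i.castSucc
    have h3 : 0 ≤ x.al i.castSucc * net.gain i.castSucc :=
      mul_nonneg (al_nonneg (alloc_of_mem hs) _) (net.gain_pos _).le
    have hr : r.z i = x.z i - 2 + x.t i.castSucc + r.t i.castSucc := by linarith
    simp only [convexCon, hr] at hc2
    have h4 : (1 - x.t i.castSucc) * (x.z i + x.t i.castSucc - 1) =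
        -(x.al i.castSucc * net.gain i.castSucc) := by linarith
    by_contra! hcon
    have := mul_pos (sub_pos.mpr hcon)
      (by linarith : 0 < x.z i + x.t i.castSucc - 1)
    linarith
  · left
    simp only [convexCon] at h0
    linarith

theorem IsRun.mem_splitFeasible {x : ℕ → Var M} (hx : net.IsRun x) (τ : ℕ) :
    x τ ∈ net.splitFeasible := by
  cases τ with
  | zero => exact hx.1
  | succ τ => exact net.convexFeasible_subset _ (hx.2 τ).1

theorem IsRun.t_pos {x : ℕ → Var M} (hx : net.IsRun x) (τ : ℕ) (i : Fin (M + 1)) :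
    0 < (x (τ + 1)).t i :=
  t_pos_of_isMaxOn (hx.mem_splitFeasible τ) (hx.2 τ).1 (hx.2 τ).2 i

theorem IsRun.isKKT {x : ℕ → Var M} (hx : net.IsRun x) (τ : ℕ) :
    IsKKT objective (net.convexCon (x τ)) (x (τ + 1)) :=
  isKKT_of_isMaxOn (hx.mem_splitFeasible τ) (hx.2 τ).1 (hx.2 τ).2

/-- In the recursive case `z_{τ+1} ≤ z_τ + 1 - t_τ`. This is at most `z_τ` if step `τ` was recursive
too (`t_τ ≥ 1`), and at most `g + 2` if `z_τ` was the interference; the first step adds at most `1`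
to the initial value. -/
theorem IsRun.z_le {x : ℕ → Var M} (hx : net.IsRun x) (τ : ℕ) (i : Fin M) :
    (x τ).z i ≤ max (net.gain i.castSucc + 2) ((x 0).z i + 1) := by
  have key : ∀ τ, (x (τ + 1)).z i ≤ max (net.gain i.castSucc + 2) ((x 0).z i + 1) ∧
      (1 ≤ (x (τ + 1)).t i.castSucc ∨ (x (τ + 1)).z i ≤ net.gain i.castSucc + 1) := by
    intro τ
    have hI : net.interf (x (τ + 1)).al i.castSucc ≤ net.gain i.castSucc + 1 :=
      interf_le (alloc_of_mem (hx.mem_splitFeasible (τ + 1))) _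
    have ht := (hx.mem_splitFeasible τ).1 i.castSucc
    have h1 := le_max_left (net.gain i.castSucc + 2) ((x 0).z i + 1)
    have h2 := le_max_right (net.gain i.castSucc + 2) ((x 0).z i + 1)
    rcases z_eq_of_isKKT (hx.2 τ).1 (hx.t_pos τ) (hx.isKKT τ) i with h | ⟨h, h'⟩
    · exact ⟨by linarith, .inr (by linarith)⟩
    · refine ⟨?_, .inl h⟩
      induction τ with
      | zero => linarith
      | succ τ ih =>
        have hI' : net.interf (x (τ + 1)).al i.castSucc ≤ net.gain i.castSucc + 1 :=
          interf_le (alloc_of_mem (hx.mem_splitFeasible (τ + 1))) _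
        have ht' := (hx.mem_splitFeasible τ).1 i.castSucc
        rcases z_eq_of_isKKT (hx.2 τ).1 (hx.t_pos τ) (hx.isKKT τ) i with g | ⟨g, g'⟩
        · linarith
        · have := ih hI' ht' g g'
          linarith
  cases τ with
  | zero => exact (le_add_of_nonneg_right zero_le_one).trans (le_max_right _ _)
  | succ τ => exact (key τ).1

theorem IsRun.isBounded_range {x : ℕ → Var M} (hx : net.IsRun x) :
    Bornology.IsBounded (Set.range x) := by
  refine (isCompact_Icc (a := (0 : Var M)) (b := (fun _ => 1, fun i => net.gain i + 1,
    fun i => max (net.gain i.castSucc + 2) ((x 0).z i + 1)))).isBounded.subset ?_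
  rintro _ ⟨τ, rfl⟩
  have hs := hx.mem_splitFeasible τ
  exact ⟨⟨fun i => al_nonneg (alloc_of_mem hs) i, fun i => hs.1 i,
      fun i => zero_le_one.trans (one_le_z hs i)⟩,
    ⟨fun i => al_le_one (alloc_of_mem hs) i, fun i => t_le hs i, fun i => hx.z_le τ i⟩⟩

/-! ### Monotonicity and convergence of the objective -/

theorem IsRun.objective_le {x : ℕ → Var M} (hx : net.IsRun x) (τ : ℕ) :
    objective (x τ) ≤ objective (x (τ + 1)) :=
  (hx.2 τ).2 (net.mem_convexFeasible_self (hx.mem_splitFeasible τ))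

theorem IsRun.monotone {x : ℕ → Var M} (hx : net.IsRun x) : Monotone fun τ => objective (x τ) :=
  monotone_nat_of_le_succ hx.objective_le

theorem objective_le_prod {x : Var M} (hx : x ∈ net.splitFeasible) :
    objective x ≤ ∏ i, (net.gain i + 1) :=
  Finset.prod_le_prod (fun i _ => hx.1 i) fun i _ => t_le hx i

theorem segment_mem_convexFeasible {r x y : Var M} (hx : x ∈ net.convexFeasible r)
    (hy : y ∈ net.convexFeasible r) {s : ℝ} (hs0 : 0 ≤ s) (hs1 : s ≤ 1) :
    x + s • (y - x) ∈ net.convexFeasible r := by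
  refine ⟨fun i => ?_, fun k => ?_⟩
  · have h1 := mul_nonneg (sub_nonneg.mpr hs1) (hx.1 i)
    have h2 := mul_nonneg hs0 (hy.1 i)
    change 0 ≤ x.t i + s * (y.t i - x.t i)
    linarith
  · exact (add_nonneg (mul_nonneg (sub_nonneg.mpr hs1) (hx.2 k)) (mul_nonneg hs0 (hy.2 k))).trans
      (net.le_convexCon_segment r x y k hs0 hs1)

/-- The inequality of arithmetic and geometric means in each factor, strict where the coordinates
differ. -/
theorem objective_mul_lt_sq_midpoint {x y : Var M} (hx : ∀ i, 0 < x.t i) (hy : ∀ i, 0 < y.t i)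
    (h : x.t ≠ y.t) :
    objective x * objective y < objective (x + (1 / 2 : ℝ) • (y - x)) ^ 2 := by
  obtain ⟨i, hi⟩ := Function.ne_iff.mp h
  simp only [objective, ← Finset.prod_mul_distrib, ← Finset.prod_pow]
  have e : ∀ j, (x + (1 / 2 : ℝ) • (y - x)).t j = x.t j + 1 / 2 * (y.t j - x.t j) := fun j => rfl
  simp only [e]
  refine Finset.prod_lt_prod (fun j _ => mul_pos (hx j) (hy j)) (fun j _ => ?_)
    ⟨i, Finset.mem_univ i, ?_⟩
  · linarith [sq_nonneg (x.t j - y.t j)]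
  · have := sq_pos_of_ne_zero (sub_ne_zero.mpr hi)
    linarith

theorem IsRun.objective_lt {x : ℕ → Var M} (hx : net.IsRun x) (τ : ℕ)
    (hne : (x (τ + 1)).t ≠ (x τ).t) : objective (x τ) < objective (x (τ + 1)) := by
  refine (hx.objective_le τ).lt_of_ne fun heq => ?_
  have hs := hx.mem_splitFeasible τ
  have hpos' := objective_pos (hx.t_pos τ)
  have hpos : ∀ i, 0 < (x τ).t i := t_pos_of_objective_pos hs.1 (heq ▸ hpos')
  have h1 := objective_mul_lt_sq_midpoint hpos (hx.t_pos τ) hne.symm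
  -- With equal objective values, the feasible midpoint would beat the maximum.
  have h2 : objective (x τ + (1 / 2 : ℝ) • (x (τ + 1) - x τ)) ≤ objective (x (τ + 1)) :=
    (hx.2 τ).2 (segment_mem_convexFeasible (net.mem_convexFeasible_self hs) (hx.2 τ).1
      (by norm_num) (by norm_num))
  have h3 : 0 ≤ objective (x τ + (1 / 2 : ℝ) • (x (τ + 1) - x τ)) :=
    Finset.prod_nonneg fun i _ =>
      (segment_mem_convexFeasible (net.mem_convexFeasible_self hs) (hx.2 τ).1
        (by norm_num : (0 : ℝ) ≤ 1 / 2) (by norm_num)).1 i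
  rw [heq, ← sq] at h1
  exact absurd (pow_le_pow_left₀ h3 h2 2) (not_le.mpr h1)

theorem IsRun.exists_tendsto {x : ℕ → Var M} (hx : net.IsRun x) :
    ∃ L : ℝ, Tendsto (fun τ => objective (x τ)) atTop (𝓝 L) :=
  ⟨_, tendsto_atTop_ciSup hx.monotone
    ⟨_, Set.forall_mem_range.mpr fun τ => objective_le_prod (hx.mem_splitFeasible τ)⟩⟩

theorem _root_.Filter.Tendsto.exists_forall_abs_sub_lt {u : ℕ → ℝ} {L : ℝ}
    (h : Tendsto u atTop (𝓝 L)) {ε : ℝ} (hε : 0 < ε) :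
    ∃ T : ℕ, ∀ τ ≥ T, |u (τ + 1) - u τ| < ε ∧ |u τ - L| < ε := by
  obtain ⟨T, hT⟩ := Metric.tendsto_atTop.mp h (ε / 2) (half_pos hε)
  refine ⟨T, fun τ hτ => ?_⟩
  have h1 := hT τ hτ
  have h2 := hT (τ + 1) (by omega)
  rw [Real.dist_eq, abs_lt] at h1 h2
  exact ⟨abs_lt.mpr ⟨by linarith, by linarith⟩, abs_lt.mpr ⟨by linarith, by linarith⟩⟩

/-! ### Limit points -/

variable (net) in
theorem isClosed_splitFeasible : IsClosed net.splitFeasible := by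
  have h1 : IsClosed {x : Var M | ∀ i, 0 ≤ x.t i} := by
    simp only [Set.ofPred_forall]
    exact isClosed_iInter fun i => isClosed_le continuous_const (by fun_prop)
  have h2 : IsClosed {x : Var M | ∀ k, 0 ≤ net.splitCon k x} := by
    simp only [Set.ofPred_forall]
    exact isClosed_iInter fun k =>
      isClosed_le continuous_const (net.differentiable_splitCon k).continuous
  exact h1.inter h2

variable (net) in
theorem continuous_convexCon_product (i : Fin M) (x : Var M) :
    Continuous fun r : Var M => net.convexCon r (.product i) x := by
  simp only [convexCon]
  fun_prop

/-- A competitor at `y`, moved slightly to make the product constraints strict, stays feasible for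
the programs at iterates close to `y`, as only those constraints depend on the reference point. Its
objective is thus at most that of a next iterate, hence at most `L = objective y`. The next iterates
need not approach `y`. -/
theorem IsRun.isMaxOn_of_mapClusterPt {x : ℕ → Var M} (hx : net.IsRun x) {y : Var M}
    (hy : MapClusterPt y atTop x) :
    y ∈ net.splitFeasible ∧ (∀ i, 0 < y.t i) ∧ IsMaxOn objective (net.convexFeasible y) y := by
  obtain ⟨L, hL⟩ := hx.exists_tendsto
  obtain ⟨U, hU, hUy⟩ := mapClusterPt_iff_ultrafilter.mp hy
  have hle : ∀ τ, objective (x τ) ≤ L := fun τ => hx.monotone.ge_of_tendsto hL τ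
  have hys : y ∈ net.splitFeasible :=
    net.isClosed_splitFeasible.mem_of_tendsto hUy (Eventually.of_forall hx.mem_splitFeasible)
  have hyL : objective y = L :=
    tendsto_nhds_unique ((differentiable_objective.continuous.tendsto y).comp hUy) (hL.mono_left hU)
  refine ⟨hys, t_pos_of_objective_pos hys.1 ?_, fun w hw => ?_⟩
  · rw [hyL]
    exact (objective_pos (hx.t_pos 0)).trans_le (hle 1)
  obtain ⟨s, hs, -, hsprod⟩ := exists_strictly_feasible hys
  change objective w ≤ objective y
  have hseg : ∀ ε ∈ Set.Ioo (0 : ℝ) 1, objective (w + ε • (s - w)) ≤ objective y := by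
    intro ε hε
    have hv := segment_mem_convexFeasible hw hs hε.1.le hε.2.le
    have hvprod : ∀ i, 0 < net.convexCon y (.product i) (w + ε • (s - w)) := fun i =>
      (add_pos_of_nonneg_of_pos (mul_nonneg (sub_nonneg.mpr hε.2.le) (hw.2 _))
        (mul_pos hε.1 (hsprod i))).trans_le (net.le_convexCon_segment y w s _ hε.1.le hε.2.le)
    have hev : ∀ᶠ τ in (U : Filter ℕ), ∀ i,
        0 < net.convexCon (x τ) (.product i) (w + ε • (s - w)) :=
      eventually_all.mpr fun i =>
        (((net.continuous_convexCon_product i _).tendsto y).comp hUy).eventually_const_lt (hvprod i)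
    obtain ⟨τ, hτ⟩ := hev.exists
    rw [hyL]
    refine le_trans ((hx.2 τ).2 ⟨hv.1, fun k => ?_⟩) (hle (τ + 1))
    cases k with
    | product i => exact (hτ i).le
    | interf i => exact hv.2 (.interf i)
    | last => exact hv.2 .last
    | alloc k => exact hv.2 (.alloc k)
  have hlim : Tendsto (fun ε : ℝ => objective (w + ε • (s - w))) (𝓝[>] 0) (𝓝 (objective w)) := by
    have hcont : Continuous fun ε : ℝ => objective (w + ε • (s - w)) :=
      differentiable_objective.continuous.comp (by fun_prop)
    have := hcont.tendsto 0
    rw [zero_smul, add_zero] at this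
    exact this.mono_left nhdsWithin_le_nhds
  refine le_of_tendsto hlim ?_
  filter_upwards [Ioo_mem_nhdsGT (zero_lt_one' ℝ)] with ε hε using hseg ε hε

theorem fderiv_splitCon (x : Var M) (k : SplitIdx M) :
    fderiv ℝ (net.splitCon k) x = fderiv ℝ (net.convexCon x k) x := by
  refine ContinuousLinearMap.ext fun d => ?_
  rw [fderiv_splitCon_apply, fderiv_convexCon_apply]

theorem isKKT_splitCon {x : Var M} (h : IsKKT objective (net.convexCon x) x) :
    IsKKT objective net.splitCon x := by
  obtain ⟨h1, -, h3, lam, h4, h5, h6⟩ := h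
  simp only [convexCon_self] at h3 h5
  simp only [← fderiv_splitCon] at h6
  exact ⟨h1, fun k => net.differentiable_splitCon k x, h3, lam, h4, h5, h6⟩

/-! ### The KKT conditions of the problem in `(α, t)` -/

theorem differentiableAt_slackCon {y : (Fin (M + 1) → ℝ) × (Fin (M + 1) → ℝ)}
    (hy : ∀ i, net.interf y.1 i ≠ 0) (k : SlackIdx M) : DifferentiableAt ℝ (net.slackCon k) y := by
  have h1 := net.differentiable_interf
  have h2 := net.differentiable_allocCon
  cases k with
  | rate i =>
    have := hy i
    unfold slackCon sinr
    fun_prop (disch := assumption)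
  | alloc k =>
    unfold slackCon
    fun_prop

theorem fderiv_slackCon_rate_apply {y : (Fin (M + 1) → ℝ) × (Fin (M + 1) → ℝ)}
    (hy : ∀ i, net.interf y.1 i ≠ 0) (i : Fin (M + 1))
    (d : (Fin (M + 1) → ℝ) × (Fin (M + 1) → ℝ)) :
    fderiv ℝ (net.slackCon (.rate i)) y d =
      (d.1 i * net.gain i * net.interf y.1 i - y.1 i * net.gain i * net.interfLin d.1 i) /
        net.interf y.1 i ^ 2 - d.2 i := by
  refine fderiv_apply_eq_of_hasDerivAt (differentiableAt_slackCon hy _) ?_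
  have e : ∀ s : ℝ, net.slackCon (.rate i) (y + s • d) =
      (y.1 i + s * d.1 i) * net.gain i / (net.interf y.1 i + s * net.interfLin d.1 i) -
        (y.2 i + s * d.2 i - 1) := fun s => by
    simp only [slackCon, sinr, Prod.fst_add, Prod.smul_fst, interf_add_smul]
    rfl
  simp only [e]
  have lin : ∀ a b : ℝ, HasDerivAt (fun s : ℝ => a + s * b) b 0 := fun a b => by
    simpa using ((hasDerivAt_id (0 : ℝ)).mul_const b).const_add a
  have := ((((lin (y.1 i) (d.1 i)).mul_const (net.gain i)).fun_div
    (lin (net.interf y.1 i) (net.interfLin d.1 i)) (by simpa using hy i)).fun_sub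
      ((lin (y.2 i) (d.2 i)).sub_const 1))
  simpa using this

theorem fderiv_slackCon_alloc_apply {y : (Fin (M + 1) → ℝ) × (Fin (M + 1) → ℝ)}
    (hy : ∀ i, net.interf y.1 i ≠ 0) (k : AllocIdx M)
    (d : (Fin (M + 1) → ℝ) × (Fin (M + 1) → ℝ)) :
    fderiv ℝ (net.slackCon (.alloc k)) y d = net.allocLin k d.1 :=
  fderiv_apply_eq_of_quadratic (b := 0) (differentiableAt_slackCon hy _) fun s => by
    simp only [slackCon, Prod.fst_add, Prod.smul_fst, allocCon_add_smul]
    ring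

/-- Positive rates make the required signal power in the rate constraint strictly positive. -/
theorem al_pos {al : Fin (M + 1) → ℝ} (h : ∀ k, 0 ≤ net.allocCon k al)
    (hR : ∀ i, 0 < net.Rbar i) (i : Fin (M + 1)) : 0 < al i := by
  have h1 := h (.qos i)
  simp only [allocCon] at h1
  have h2 : 0 < (2 : ℝ) ^ net.Rbar i - 1 :=
    sub_pos.mpr (Real.one_lt_rpow (by norm_num) (hR i))
  have h3 := mul_pos h2 (zero_lt_one.trans_le (one_le_interf h i))
  exact pos_of_mul_pos_left (by linarith) (net.gain_pos i).le

/-- With reference point `x`, the interference multiplier is the product multiplier times `t_i - 1`.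
Tightness and `α_i > 0` give `t_i > 1`, so both constraints are tight and `z` can be eliminated. -/
theorem isKKT_slackCon {x : Var M} (hx : x ∈ net.splitFeasible) (ht : ∀ i, 0 < x.t i)
    (hR : ∀ i, 0 < net.Rbar i) (h : IsKKT objective (net.convexCon x) x) :
    IsKKT slackObjective net.slackCon (x.al, x.t) := by
  obtain ⟨-, -, -, lam, hlam, hcomp, hstat⟩ := h
  simp only [convexCon_self] at hcomp
  have hI1 : ∀ i, 1 ≤ net.interf x.al i := one_le_interf (alloc_of_mem hx)
  have hI : ∀ i, net.interf x.al i ≠ 0 := fun i => (zero_lt_one.trans_le (hI1 i)).ne'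
  have hpos := multiplier_pos_of_stationarity hstat hlam ht
  have htight : ∀ i, x.al (Fin.castSucc i) * net.gain i.castSucc =
      x.z i * (x.t i.castSucc - 1) := fun i => by
    have := (mul_eq_zero.mp (hcomp (.product i))).resolve_left (hpos i).ne'
    simp only [splitCon] at this
    linarith
  have hz : ∀ i, x.z i = net.interf x.al i.castSucc := fun i => by
    have h1 := multiplier_eq_of_stationarity hstat i
    have h2 : 0 < x.t i.castSucc - 1 := by
      have : 0 < x.z i * (x.t i.castSucc - 1) := by
        rw [← htight]
        exact mul_pos (al_pos (alloc_of_mem hx) hR _) (net.gain_pos _)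
      exact pos_of_mul_pos_right this (zero_le_one.trans (one_le_z hx i))
    have h3 : lam (.interf i) ≠ 0 := by
      have : lam (.interf i) = lam (.product i) * (x.t i.castSucc - 1) := by
        rw [h1]; ring
      rw [this]
      exact (mul_pos (hpos i) h2).ne'
    exact sub_eq_zero.mp ((mul_eq_zero.mp (hcomp (.interf i))).resolve_left h3)
  refine ⟨differentiable_slackObjective _, differentiableAt_slackCon hI,
    (slackFeasible_of_mem hx).2, fun
      -- The rate constraint of (P) is the product constraint divided by `z_i`, hence the factor
      -- `x.z i`; receiver `M` has no `z`.
      | .rate i => Fin.lastCases (motive := fun _ => ℝ) (lam .last)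
          (fun i => lam (.product i) * x.z i) i
      | .alloc k => lam (.alloc k), ?_, ?_, ?_⟩
  · rintro (i | k)
    · induction i using Fin.lastCases with
      | last => simpa using hlam .last
      | cast i =>
        simpa using mul_nonneg (hlam (.product i)) (zero_le_one.trans (one_le_z hx i))
    · exact hlam _
  · rintro (i | k)
    · induction i using Fin.lastCases with
      | last =>
        have := hcomp .last
        simp only [splitCon] at this
        simpa [slackCon, sinr, interf_last] using this
      | cast i =>
        have h1 : net.slackCon (.rate i.castSucc) (x.al, x.t) = 0 := by
          simp only [slackCon, sinr, htight, hz]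
          rw [mul_div_cancel_left₀ _ (hI _), sub_self]
        rw [h1, mul_zero]
    · exact hcomp (.alloc k)
  · refine ContinuousLinearMap.ext fun d => ?_
    -- Let `z` move with the interference: the interference constraints then have zero derivative
    -- and drop out.
    have key := stationarity_apply hstat (d.1, d.2, fun i => net.interfLin d.1 i.castSucc)
    rw [sum_splitIdx] at key
    simp only [add_apply, sum_apply, FunLike.coe_smul, Pi.smul_apply, smul_eq_mul, zero_apply,
      fderiv_slackObjective_apply, sum_slackIdx, Fin.sum_univ_castSucc (n := M),
      fderiv_slackCon_rate_apply (y := (x.al, x.t)) hI,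
      fderiv_slackCon_alloc_apply (y := (x.al, x.t)) hI, Fin.lastCases_last,
      Fin.lastCases_castSucc]
    rw [← key]
    have hprod : ∀ i : Fin M, lam (.product i) * x.z i *
        ((d.1 i.castSucc * net.gain i.castSucc * net.interf x.al i.castSucc -
          x.al i.castSucc * net.gain i.castSucc * net.interfLin d.1 i.castSucc) /
          net.interf x.al i.castSucc ^ 2 - d.2 i.castSucc) =
        lam (.product i) * net.convexLin x x (.product i)
          (d.1, d.2, fun i => net.interfLin d.1 i.castSucc) := fun i => by
      simp only [htight, convexLin, hz]
      have := hI i.castSucc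
      field_simp
      ring
    simp only [hprod, interf_last, interfLin_last]
    simp [convexLin, Fin.sum_univ_castSucc (n := M)]
    ring

end Network

end NomaSumRate

end

/-! ### The main theorem -/

open NomaSumRate in
theorem proposition1 {N M : ℕ} (hM : 1 ≤ M) (net : Network N M) :
    -- from every feasible point the algorithm can be run: each convex program is solvable
    (∀ x₀ ∈ net.splitFeasible, ∃ x : ℕ → Var M, net.IsRun x ∧ x 0 = x₀) ∧
    ∀ x : ℕ → Var M, net.IsRun x →
      -- all iterates are feasible for the convex program at them and for the original problems
      (∀ τ, x τ ∈ net.convexFeasible (x τ) ∧ x τ ∈ net.splitFeasible ∧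
        ((x τ).al, (x τ).t) ∈ net.slackFeasible) ∧
      -- the objective is monotone, and increases strictly as long as `t` changes
      (Monotone fun τ => objective (x τ)) ∧
      (∀ τ, (x (τ + 1)).t ≠ (x τ).t → objective (x τ) < objective (x (τ + 1))) ∧
      -- it converges, and any tolerance is met after finitely many iterations
      (∃ L : ℝ, Tendsto (fun τ => objective (x τ)) atTop (𝓝 L) ∧
        ∀ ε : ℝ, 0 < ε → ∃ T : ℕ, ∀ τ ≥ T,
          |objective (x (τ + 1)) - objective (x τ)| < ε ∧ |objective (x τ) - L| < ε) ∧
      -- each iterate satisfies the KKT conditions of the convex program that it solves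
      (∀ τ, (∀ i, 0 < (x (τ + 1)).t i) ∧
        IsKKT objective (net.convexCon (x τ)) (x (τ + 1))) ∧
      -- the iterates are bounded, and limit points satisfy the KKT conditions of the original
      -- nonconvex problems
      Bornology.IsBounded (Set.range x) ∧
      ∀ y : Var M, MapClusterPt y atTop x →
        (∀ i, 0 < y.t i) ∧ IsKKT objective net.splitCon y ∧
        ((∀ i, 0 < net.Rbar i) → IsKKT slackObjective net.slackCon (y.al, y.t)) := by
  refine ⟨fun x₀ hx₀ => Network.exists_isRun hx₀, fun x hx => ?_⟩
  obtain ⟨L, hL⟩ := hx.exists_tendsto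
  refine ⟨fun τ => ⟨net.mem_convexFeasible_self (hx.mem_splitFeasible τ), hx.mem_splitFeasible τ,
      Network.slackFeasible_of_mem (hx.mem_splitFeasible τ)⟩, hx.monotone, hx.objective_lt,
    ⟨L, hL, fun ε hε => hL.exists_forall_abs_sub_lt hε⟩, fun τ => ⟨hx.t_pos τ, hx.isKKT τ⟩,
    hx.isBounded_range, fun y hy => ?_⟩
  obtain ⟨hys, hyt, hymax⟩ := hx.isMaxOn_of_mapClusterPt hy
  have hkkt := Network.isKKT_of_isMaxOn hys (net.mem_convexFeasible_self hys) hymax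
  exact ⟨hyt, Network.isKKT_splitCon hkkt,
    fun hR => Network.isKKT_slackCon hys hyt hR hkkt⟩
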